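/- Let $A$ be an $f$-algebra, that is, a real Riesz space with an associative bilinear multiplication (a unit is not assumed) such that $ab\ge 0$ whenever $a,b\ge 0$, and such that $a\wedge b=0$ and $c\ge 0$ imply $(ca)\wedge b=(ac)\wedge b=0$. Let $A^{\sim}$ be the order dual of $A$, i.e. the Riesz space of all order bounded linear functionals on $A$, and assume that $A^{\sim}$ separates the points of $A$: if $f(a)=0$ for all $f\in A^{\sim}$, then $a=0$. Let $(A^{\sim})^{\sim}_{n}$ be the order continuous dual of $A^{\sim}$, i.e. the Riesz space of all order bounded and order continuous linear functionals on $A^{\sim}$. For $f\in A^{\sim}$, $a\in A$ and $F\in (A^{\sim})^{\sim}_{n}$ define $f\cdot a\in A^{\sim}$ by $(f\cdot a)(b)=f(ab)$ for $b\in A$, and $F\cdot f\in A^{\sim}$ by $(F\cdot f)(a)=F(f\cdot a)$ for $a\in A$. Write $u\perp v$ if $|u|\wedge|v|=0$. Then for all $f\in A^{\sim}$ and $F\in (A^{\sim})^{\sim}_{n}$, $$|F\cdot f|=|F|\cdot |f|.$$ Moreover, if $f,g\in A^{\sim}$ and $f\perp g$, then $F\cdot f\perp G\cdot g$ for all $F,G\in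 (A^{\sim})^{\sim}_{n}$. -/

import Mathlib

universe u

set_option linter.unusedSectionVars false

/-- A real Riesz space (vector lattice) is a real vector space `E` with a lattice order satisfying
`[IsOrderedAddMonoid E]` and `[IsOrderedModule ℝ E]`. Two elements are disjoint, `x ⊥ y`, if
`|x| ⊓ |y| = 0`. -/
def RieszDisjoint {E : Type u} [AddCommGroup E] [Lattice E] (x y : E) : Prop :=
  |x| ⊓ |y| = 0

/-- An `f`-algebra: a Riesz space with an associative bilinear multiplication (not assumed
commutative or unital; associativity and bilinearity are `NonUnitalRing`, `IsScalarTower` and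
`SMulCommClass`) such that products of nonnegative elements are nonnegative and
`a ⊓ b = 0`, `0 ≤ c` imply `(c * a) ⊓ b = 0` and `(a * c) ⊓ b = 0`. -/
class IsFAlgebra (A : Type u) [NonUnitalRing A] [Lattice A] [IsOrderedAddMonoid A] [Module ℝ A]
    [IsOrderedModule ℝ A] [IsScalarTower ℝ A A] [SMulCommClass ℝ A A] : Prop where
  mul_nonneg : ∀ a b : A, 0 ≤ a → 0 ≤ b → 0 ≤ a * b
  mul_left_inf : ∀ a b c : A, a ⊓ b = 0 → 0 ≤ c → (c * a) ⊓ b = 0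
  mul_right_inf : ∀ a b c : A, a ⊓ b = 0 → 0 ≤ c → (a * c) ⊓ b = 0

/-! ### The order dual of a Riesz space -/

section Dual

variable (E : Type u) [AddCommGroup E] [Lattice E] [IsOrderedAddMonoid E] [Module ℝ E]
  [IsOrderedModule ℝ E]

/-- The linear functionals that are bounded on every order interval. -/
def orderBoundedFunctionals : Submodule ℝ (E →ₗ[ℝ] ℝ) where
  carrier := {f | ∀ a b : E, ∃ c d : ℝ, ∀ x, a ≤ x → x ≤ b → c ≤ f x ∧ f x ≤ d}
  add_mem' := by
    intro f g hf hg a b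
    obtain ⟨c, d, h⟩ := hf a b
    obtain ⟨c', d', h'⟩ := hg a b
    exact ⟨c + c', d + d', fun x hx hx' => ⟨add_le_add (h x hx hx').1 (h' x hx hx').1,
      add_le_add (h x hx hx').2 (h' x hx hx').2⟩⟩
  zero_mem' := fun a b => ⟨0, 0, fun x _ _ => by simp⟩
  smul_mem' := by
    intro r f hf a b
    obtain ⟨c, d, h⟩ := hf a b
    rcases le_total 0 r with hr | hr
    · exact ⟨r * c, r * d, fun x hx hx' => ⟨mul_le_mul_of_nonneg_left (h x hx hx').1 hr,
        mul_le_mul_of_nonneg_left (h x hx hx').2 hr⟩⟩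
    · exact ⟨r * d, r * c, fun x hx hx' => ⟨mul_le_mul_of_nonpos_left (h x hx hx').2 hr,
        mul_le_mul_of_nonpos_left (h x hx hx').1 hr⟩⟩

/-- The order dual `E~`: all order bounded linear functionals on `E`. It is ordered by
`f ≤ g ↔ ∀ x ≥ 0, f x ≤ g x`, and is a Riesz space. -/
def RieszDual : Type u := ↥(orderBoundedFunctionals E)

namespace RieszDual

noncomputable instance : AddCommGroup (RieszDual E) :=
  inferInstanceAs (AddCommGroup ↥(orderBoundedFunctionals E))

noncomputable instance : Module ℝ (RieszDual E) :=
  inferInstanceAs (Module ℝ ↥(orderBoundedFunctionals E))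

variable {E}

/-- The underlying linear functional. -/
def toLin (f : RieszDual E) : E →ₗ[ℝ] ℝ := f.1

instance : CoeFun (RieszDual E) (fun _ => E → ℝ) := ⟨fun f => f.toLin⟩

/-- An order bounded linear functional as an element of the order dual. -/
def mk (f : E →ₗ[ℝ] ℝ)
    (hf : ∀ a b : E, ∃ c d : ℝ, ∀ x, a ≤ x → x ≤ b → c ≤ f x ∧ f x ≤ d) : RieszDual E :=
  ⟨f, hf⟩

@[simp] theorem mk_apply (f : E →ₗ[ℝ] ℝ) (hf) (x : E) : (mk f hf) x = f x := rfl
@[simp] theorem add_apply (f g : RieszDual E) (x : E) : (f + g) x = f x + g x := rfl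
@[simp] theorem sub_apply (f g : RieszDual E) (x : E) : (f - g) x = f x - g x := rfl
@[simp] theorem neg_apply (f : RieszDual E) (x : E) : (-f) x = - f x := rfl
@[simp] theorem zero_apply (x : E) : (0 : RieszDual E) x = 0 := rfl
@[simp] theorem smul_apply (r : ℝ) (f : RieszDual E) (x : E) : (r • f) x = r * f x := rfl

theorem bounded (f : RieszDual E) (a b : E) :
    ∃ c d : ℝ, ∀ x, a ≤ x → x ≤ b → c ≤ f x ∧ f x ≤ d := f.2 a b

theorem ext_apply {f g : RieszDual E} (h : ∀ x, f x = g x) : f = g :=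
  Subtype.ext (LinearMap.ext h)

theorem ext_nonneg {f g : RieszDual E} (h : ∀ x, 0 ≤ x → f x = g x) : f = g := by
  apply ext_apply
  intro x
  rw [← posPart_sub_negPart x, map_sub, map_sub, h _ (posPart_nonneg x), h _ (negPart_nonneg x)]

instance : PartialOrder (RieszDual E) where
  le f g := ∀ x : E, 0 ≤ x → f x ≤ g x
  le_refl f x _ := le_rfl
  le_trans f g h h₁ h₂ x hx := (h₁ x hx).trans (h₂ x hx)
  le_antisymm f g h₁ h₂ := ext_nonneg fun x hx => le_antisymm (h₁ x hx) (h₂ x hx)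

theorem le_def {f g : RieszDual E} : f ≤ g ↔ ∀ x : E, 0 ≤ x → f x ≤ g x := Iff.rfl

instance : IsOrderedAddMonoid (RieszDual E) where
  add_le_add_left f g h k x hx := by simpa using h x hx

instance : IsOrderedModule ℝ (RieszDual E) where
  smul_le_smul_of_nonneg_left := fun r hr f g h x hx => by
    simpa using mul_le_mul_of_nonneg_left (h x hx) hr
  smul_le_smul_of_nonneg_right := fun f hf r s h x hx => by
    simpa using mul_le_mul_of_nonneg_right h (by simpa using hf x hx)

/-- `sup {f y | 0 ≤ y ≤ x}`, the value of `f⁺` at `x ≥ 0`. -/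
noncomputable def posVal (f : RieszDual E) (x : E) : ℝ := sSup (f '' Set.Icc 0 x)

theorem bddAbove_image (f : RieszDual E) (x : E) : BddAbove (f '' Set.Icc 0 x) := by
  obtain ⟨c, d, h⟩ := f.bounded 0 x
  refine ⟨d, ?_⟩
  rintro _ ⟨y, hy, rfl⟩
  exact (h y hy.1 hy.2).2

theorem le_posVal (f : RieszDual E) {x y : E} (hy : 0 ≤ y) (hyx : y ≤ x) : f y ≤ f.posVal x :=
  le_csSup (f.bddAbove_image x) ⟨y, ⟨hy, hyx⟩, rfl⟩

theorem posVal_le (f : RieszDual E) {x : E} (hx : 0 ≤ x) {c : ℝ}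
    (h : ∀ y, 0 ≤ y → y ≤ x → f y ≤ c) : f.posVal x ≤ c := by
  have hne : (Set.Icc 0 x).Nonempty := ⟨0, le_rfl, hx⟩
  apply csSup_le (hne.image _)
  rintro _ ⟨y, hy, rfl⟩
  exact h y hy.1 hy.2

theorem posVal_nonneg (f : RieszDual E) {x : E} (hx : 0 ≤ x) : 0 ≤ f.posVal x := by
  simpa using f.le_posVal le_rfl hx

theorem posVal_zero (f : RieszDual E) : f.posVal 0 = 0 :=
  le_antisymm (f.posVal_le le_rfl fun y h h' => by simp [le_antisymm h' h])
    (f.posVal_nonneg le_rfl)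

theorem posVal_add (f : RieszDual E) {x y : E} (hx : 0 ≤ x) (hy : 0 ≤ y) :
    f.posVal (x + y) = f.posVal x + f.posVal y := by
  apply le_antisymm
  · apply f.posVal_le (add_nonneg hx hy)
    intro z hz hzxy
    have h1 : z = z ⊓ x + (z - z ⊓ x) := by abel
    have h2 : z - z ⊓ x ≤ y := by
      rw [sub_le_iff_le_add, add_inf]
      exact le_inf (by simpa using hy) (by rwa [add_comm])
    rw [h1, map_add]
    exact add_le_add (f.le_posVal (le_inf hz hx) inf_le_right)
      (f.le_posVal (sub_nonneg.2 inf_le_left) h2)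
  · rw [← le_sub_iff_add_le]
    apply f.posVal_le hx
    intro z hz hzx
    rw [le_sub_iff_add_le, add_comm, ← le_sub_iff_add_le]
    apply f.posVal_le hy
    intro w hw hwy
    rw [le_sub_iff_add_le, ← map_add]
    exact f.le_posVal (add_nonneg hw hz) (by rw [add_comm]; exact add_le_add hzx hwy)

theorem posVal_smul (f : RieszDual E) {r : ℝ} (hr : 0 ≤ r) {x : E} (hx : 0 ≤ x) :
    f.posVal (r • x) = r * f.posVal x := by
  rcases hr.eq_or_lt with rfl | hr'
  · simp [posVal_zero]
  apply le_antisymm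
  · apply f.posVal_le (smul_nonneg hr hx)
    intro y hy hyx
    have h1 : r⁻¹ • y ≤ x := by
      have := smul_le_smul_of_nonneg_left hyx (inv_nonneg.2 hr)
      rwa [smul_smul, inv_mul_cancel₀ hr'.ne', one_smul] at this
    have h2 := f.le_posVal (smul_nonneg (inv_nonneg.2 hr) hy) h1
    rw [map_smul, smul_eq_mul, inv_mul_le_iff₀ hr'] at h2
    exact h2
  · rw [← le_div_iff₀' hr']
    apply f.posVal_le hx
    intro y hy hyx
    rw [le_div_iff₀' hr', ← smul_eq_mul, ← map_smul]
    exact f.le_posVal (smul_nonneg hr hy) (smul_le_smul_of_nonneg_left hyx hr)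

theorem posVal_sub_eq (f : RieszDual E) {a b c d : E} (ha : 0 ≤ a) (hb : 0 ≤ b) (hc : 0 ≤ c)
    (hd : 0 ≤ d) (h : a - b = c - d) :
    f.posVal a - f.posVal b = f.posVal c - f.posVal d := by
  have h1 : a + d = c + b := by rwa [sub_eq_sub_iff_add_eq_add] at h
  have h2 := f.posVal_add ha hd
  rw [h1, f.posVal_add hc hb] at h2
  linarith

/-- The positive part `f⁺` of `f` as a linear functional. -/
noncomputable def posLin (f : RieszDual E) : E →ₗ[ℝ] ℝ where
  toFun x := f.posVal x⁺ - f.posVal x⁻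
  map_add' x y := by
    have h := f.posVal_sub_eq (posPart_nonneg (x + y)) (negPart_nonneg (x + y))
      (add_nonneg (posPart_nonneg x) (posPart_nonneg y))
      (add_nonneg (negPart_nonneg x) (negPart_nonneg y))
      (by rw [posPart_sub_negPart, add_sub_add_comm, posPart_sub_negPart, posPart_sub_negPart])
    rw [h, f.posVal_add (posPart_nonneg x) (posPart_nonneg y),
      f.posVal_add (negPart_nonneg x) (negPart_nonneg y)]
    ring
  map_smul' r x := by
    rcases le_total 0 r with hr | hr
    · have h := f.posVal_sub_eq (posPart_nonneg (r • x)) (negPart_nonneg (r • x))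
        (smul_nonneg hr (posPart_nonneg x)) (smul_nonneg hr (negPart_nonneg x))
        (by rw [posPart_sub_negPart, ← smul_sub, posPart_sub_negPart])
      rw [h, f.posVal_smul hr (posPart_nonneg x), f.posVal_smul hr (negPart_nonneg x)]
      simp only [RingHom.id_apply, smul_eq_mul]
      ring
    · have hr' : 0 ≤ -r := neg_nonneg.2 hr
      have h := f.posVal_sub_eq (posPart_nonneg (r • x)) (negPart_nonneg (r • x))
        (smul_nonneg hr' (negPart_nonneg x)) (smul_nonneg hr' (posPart_nonneg x))
        (by rw [posPart_sub_negPart, ← smul_sub, ← neg_sub x⁺ x⁻, posPart_sub_negPart,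
              neg_smul_neg])
      rw [h, f.posVal_smul hr' (posPart_nonneg x), f.posVal_smul hr' (negPart_nonneg x)]
      simp only [RingHom.id_apply, smul_eq_mul]
      ring

theorem posLin_apply (f : RieszDual E) {x : E} (hx : 0 ≤ x) : f.posLin x = f.posVal x := by
  change f.posVal x⁺ - f.posVal x⁻ = _
  rw [posPart_of_nonneg hx, negPart_of_nonneg hx, posVal_zero, sub_zero]

theorem bounded_of_nonneg (f : E →ₗ[ℝ] ℝ) (hf : ∀ x, 0 ≤ x → 0 ≤ f x) (a b : E) :
    ∃ c d : ℝ, ∀ x, a ≤ x → x ≤ b → c ≤ f x ∧ f x ≤ d := by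
  refine ⟨f a, f b, fun x hx hx' => ⟨?_, ?_⟩⟩
  · simpa using hf _ (sub_nonneg.2 hx)
  · simpa using hf _ (sub_nonneg.2 hx')

/-- The positive part of `f`, given by `x ↦ sup {f y | 0 ≤ y ≤ x}` for `x ≥ 0`. -/
noncomputable def pos (f : RieszDual E) : RieszDual E :=
  mk f.posLin (bounded_of_nonneg _ fun x hx => by
    rw [f.posLin_apply hx]; exact f.posVal_nonneg hx)

theorem pos_apply (f : RieszDual E) {x : E} (hx : 0 ≤ x) : f.pos x = f.posVal x :=
  f.posLin_apply hx

theorem le_pos (f : RieszDual E) : f ≤ f.pos := fun x hx => by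
  rw [f.pos_apply hx]; exact f.le_posVal hx le_rfl

theorem pos_nonneg (f : RieszDual E) : 0 ≤ f.pos := fun x hx => by
  rw [f.pos_apply hx]; exact f.posVal_nonneg hx

theorem pos_le {f g : RieszDual E} (h : f ≤ g) (hg : 0 ≤ g) : f.pos ≤ g := fun x hx => by
  rw [f.pos_apply hx]
  refine f.posVal_le hx fun y hy hyx => (h y hy).trans ?_
  have := hg (x - y) (sub_nonneg.2 hyx)
  simpa using this

noncomputable instance : Lattice (RieszDual E) where
  sup f g := (f - g).pos + g
  le_sup_left f g := sub_le_iff_le_add.1 (f - g).le_pos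
  le_sup_right f g := le_add_of_nonneg_left (f - g).pos_nonneg
  sup_le f g h hf hg := le_sub_iff_add_le.1
    (pos_le (sub_le_sub_right hf g) (sub_nonneg.2 hg))
  inf f g := f - (f - g).pos
  inf_le_left f g := sub_le_self f (f - g).pos_nonneg
  inf_le_right f g := by
    have := (f - g).le_pos
    exact sub_le_comm.1 this
  le_inf h f g hf hg := le_sub_comm.1 (pos_le (sub_le_sub_left hg f) (sub_nonneg.2 hf))

theorem sup_def (f g : RieszDual E) : f ⊔ g = (f - g).pos + g := rfl

theorem inf_def (f g : RieszDual E) : f ⊓ g = f - (f - g).pos := rfl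

theorem nonneg_apply {f : RieszDual E} (hf : 0 ≤ f) {x : E} (hx : 0 ≤ x) : 0 ≤ f x := hf x hx

theorem mono {f : RieszDual E} (hf : 0 ≤ f) {x y : E} (h : x ≤ y) : f x ≤ f y := by
  have := hf (y - x) (sub_nonneg.2 h)
  simpa using this

end RieszDual

end Dual

/-! ### The order continuous dual -/

/-- A net `x` indexed by a directed set `ι` converges in order to `0` if there is a net
`y i ↓ 0` with `|x i| ≤ y i` for all `i`. -/
def OrderTendstoZero {E : Type*} [AddCommGroup E] [Lattice E] {ι : Type*} [Preorder ι]
    (x : ι → E) : Prop :=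
  ∃ y : ι → E, Antitone y ∧ IsGLB (Set.range y) 0 ∧ ∀ i, |x i| ≤ y i

section NormalDual

variable (E : Type u) [AddCommGroup E] [Lattice E] [IsOrderedAddMonoid E] [Module ℝ E]
  [IsOrderedModule ℝ E]

/-- `f` maps every net (indexed by a nonempty directed set) that converges to `0` in order to a
net of reals that converges to `0` in order. Index sets in the universe of `E` suffice to test
this, as a net may be reindexed by a set of pairs of elements of `E`. -/
def IsOrderContinuous {E : Type u} [AddCommGroup E] [Lattice E] [IsOrderedAddMonoid E]
    [Module ℝ E] [IsOrderedModule ℝ E] (f : RieszDual E) : Prop :=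
  ∀ (ι : Type u) [Preorder ι] [IsDirected ι (· ≤ ·)] [Nonempty ι] (x : ι → E),
    OrderTendstoZero x → OrderTendstoZero (fun i => f (x i))

/-- The order bounded functionals that are order continuous. -/
def orderContinuousFunctionals : Submodule ℝ (RieszDual E) where
  carrier := {f | IsOrderContinuous f}
  add_mem' := by
    intro f g hf hg ι _ _ _ x hx
    obtain ⟨s, hs, hs0, hsx⟩ := hf ι x hx
    obtain ⟨t, ht, ht0, htx⟩ := hg ι x hx
    refine ⟨fun i => s i + t i, fun i j h => add_le_add (hs h) (ht h), ⟨?_, ?_⟩, fun i =>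
      (abs_add_le _ _).trans (add_le_add (hsx i) (htx i))⟩
    · rintro _ ⟨i, rfl⟩
      exact add_nonneg (hs0.1 ⟨i, rfl⟩) (ht0.1 ⟨i, rfl⟩)
    · intro c hc
      have h1 : ∀ i j, c ≤ s i + t j := fun i j => by
        obtain ⟨k, hik, hjk⟩ := exists_ge_ge i j
        exact (hc ⟨k, rfl⟩).trans (add_le_add (hs hik) (ht hjk))
      apply hs0.2
      rintro _ ⟨i, rfl⟩
      have : c - s i ≤ 0 := by
        apply ht0.2
        rintro _ ⟨j, rfl⟩
        linarith [h1 i j]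
      linarith
  zero_mem' := by
    intro ι _ _ _ x _
    exact ⟨fun _ => 0, fun _ _ _ => le_rfl, by simp, by simp⟩
  smul_mem' := by
    intro r f hf ι _ _ _ x hx
    obtain ⟨s, hs, hs0, hsx⟩ := hf ι x hx
    rcases eq_or_ne r 0 with rfl | hr
    · exact ⟨fun _ => 0, fun _ _ _ => le_rfl, by simp, by simp⟩
    have hr' : 0 < |r| := abs_pos.2 hr
    refine ⟨fun i => |r| * s i, fun i j h => mul_le_mul_of_nonneg_left (hs h) hr'.le,
      ⟨?_, ?_⟩, fun i => ?_⟩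
    · rintro _ ⟨i, rfl⟩
      exact mul_nonneg hr'.le (hs0.1 ⟨i, rfl⟩)
    · intro c hc
      have : c / |r| ≤ 0 := by
        apply hs0.2
        rintro _ ⟨i, rfl⟩
        rw [div_le_iff₀' hr']
        exact hc ⟨i, rfl⟩
      simpa using (div_le_iff₀' hr').1 this
    · change |r * f (x i)| ≤ |r| * s i
      rw [abs_mul]
      exact mul_le_mul_of_nonneg_left (hsx i) hr'.le

/-- The order continuous dual `E~_n`: the order continuous elements of the order dual `E~`,
with the order and the lattice operations of `E~`. -/
def NormalDual : Type u := ↥(orderContinuousFunctionals E)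

variable {E}

theorem IsOrderContinuous.pos {f : RieszDual E} (hf : IsOrderContinuous f) :
    IsOrderContinuous f.pos := by
  intro ι _ _ _ x ⟨y, hy, hy0, hxy⟩
  have hyn : ∀ i, 0 ≤ y i := fun i => hy0.1 ⟨i, rfl⟩
  refine ⟨fun i => f.pos (y i), fun i j h => RieszDual.mono f.pos_nonneg (hy h), ⟨?_, ?_⟩,
    fun i => ?_⟩
  · rintro _ ⟨i, rfl⟩
    exact RieszDual.nonneg_apply f.pos_nonneg (hyn i)
  · intro c hc
    obtain ⟨i₀⟩ := ‹Nonempty ι›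
    have key : f.posVal (y i₀) ≤ f.pos (y i₀) - c := by
      apply f.posVal_le (hyn i₀)
      intro z hz hzy
      obtain ⟨s, hs, hs0, hsz⟩ := hf ι (fun j => z ⊓ y j) ⟨fun j => z ⊓ y j,
        fun i j h => inf_le_inf_left z (hy h), ⟨by
          rintro _ ⟨j, rfl⟩
          exact le_inf hz (hyn j), fun w hw => hy0.2 (by
            rintro _ ⟨j, rfl⟩
            exact (hw ⟨j, rfl⟩).trans inf_le_right)⟩,
        fun j => (abs_of_nonneg (le_inf hz (hyn j))).le⟩
      have : c - (f.pos (y i₀) - f z) ≤ 0 := by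
        apply hs0.2
        rintro _ ⟨j, rfl⟩
        obtain ⟨k, hik, hjk⟩ := exists_ge_ge i₀ j
        have h1 : z - z ⊓ y k ≤ y i₀ - y k := by
          rw [sub_le_iff_le_add, add_inf]
          refine le_inf ?_ (by simpa using hzy)
          have := hy hik
          rw [← sub_nonneg] at this
          exact le_add_of_nonneg_left this
        have h2 : f (z - z ⊓ y k) ≤ f.pos (y i₀ - y k) :=
          (f.le_pos _ (sub_nonneg.2 inf_le_left)).trans (RieszDual.mono f.pos_nonneg h1)
        rw [map_sub, map_sub] at h2
        have h3 : c ≤ f.pos (y k) := hc ⟨k, rfl⟩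
        have h4 := (le_abs_self _).trans (hsz k)
        have h5 := hs hjk
        linarith
      linarith
    rw [← f.pos_apply (hyn i₀)] at key
    linarith
  · have h := abs_le'.1 (hxy i)
    refine abs_le'.2 ⟨RieszDual.mono f.pos_nonneg h.1, ?_⟩
    have := RieszDual.mono f.pos_nonneg h.2
    rwa [map_neg] at this

namespace NormalDual

noncomputable instance : AddCommGroup (NormalDual E) :=
  inferInstanceAs (AddCommGroup ↥(orderContinuousFunctionals E))

noncomputable instance : Module ℝ (NormalDual E) :=
  inferInstanceAs (Module ℝ ↥(orderContinuousFunctionals E))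

/-- The inclusion of `E~_n` in `E~`. -/
def toDual (F : NormalDual E) : RieszDual E := F.1

noncomputable instance : Lattice (NormalDual E) :=
  Subtype.lattice
    (fun _ _ hf hg => (orderContinuousFunctionals E).add_mem
      (IsOrderContinuous.pos ((orderContinuousFunctionals E).sub_mem hf hg)) hg)
    (fun _ _ hf hg => (orderContinuousFunctionals E).sub_mem hf
      (IsOrderContinuous.pos ((orderContinuousFunctionals E).sub_mem hf hg)))

theorem isOrderContinuous (F : NormalDual E) : IsOrderContinuous F.toDual := F.2

theorem toDual_le {F G : NormalDual E} : F.toDual ≤ G.toDual ↔ F ≤ G := Iff.rfl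

@[simp] theorem toDual_add (F G : NormalDual E) : (F + G).toDual = F.toDual + G.toDual := rfl

@[simp] theorem toDual_neg (F : NormalDual E) : (-F).toDual = -F.toDual := rfl

@[simp] theorem toDual_abs (F : NormalDual E) : |F|.toDual = |F.toDual| := rfl

instance : IsOrderedAddMonoid (NormalDual E) where
  add_le_add_left F G h K := toDual_le.1 (by
    simpa using add_le_add_left (toDual_le.2 h) K.toDual)

instance : IsOrderedModule ℝ (NormalDual E) where
  smul_le_smul_of_nonneg_left := fun _ hr _ _ h =>
    toDual_le.1 (smul_le_smul_of_nonneg_left (toDual_le.2 h) hr)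
  smul_le_smul_of_nonneg_right := fun _ hF _ _ h =>
    toDual_le.1 (smul_le_smul_of_nonneg_right h (toDual_le.2 hF))

end NormalDual

end NormalDual

/-! ### The two module actions -/

section Action

variable {A : Type u} [NonUnitalRing A] [Lattice A] [IsOrderedAddMonoid A] [Module ℝ A]
  [IsOrderedModule ℝ A] [IsScalarTower ℝ A A] [SMulCommClass ℝ A A] [IsFAlgebra A]

theorem IsFAlgebra.mul_le_mul_left {a x y : A} (ha : 0 ≤ a) (h : x ≤ y) : a * x ≤ a * y := by
  have := IsFAlgebra.mul_nonneg a (y - x) ha (sub_nonneg.2 h)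
  rwa [mul_sub, sub_nonneg] at this

theorem IsFAlgebra.mul_le_mul_right {a x y : A} (ha : 0 ≤ a) (h : x ≤ y) : x * a ≤ y * a := by
  have := IsFAlgebra.mul_nonneg (y - x) a (sub_nonneg.2 h) ha
  rwa [sub_mul, sub_nonneg] at this

/-- For `f ∈ A~` and `a ∈ A`, the functional `f · a ∈ A~` with `(f · a) b = f (a * b)`. -/
noncomputable def dualActElem (f : RieszDual A) (a : A) : RieszDual A :=
  RieszDual.mk (f.toLin ∘ₗ LinearMap.mulLeft ℝ a) (by
    intro u v
    obtain ⟨c, d, h⟩ := f.bounded (a⁺ * u) (a⁺ * v)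
    obtain ⟨c', d', h'⟩ := f.bounded (a⁻ * u) (a⁻ * v)
    refine ⟨c - d', d - c', fun x hx hx' => ?_⟩
    have e : f (a * x) = f (a⁺ * x) - f (a⁻ * x) := by
      rw [← map_sub, ← sub_mul, posPart_sub_negPart]
    have h1 := h (a⁺ * x) (IsFAlgebra.mul_le_mul_left (posPart_nonneg a) hx)
      (IsFAlgebra.mul_le_mul_left (posPart_nonneg a) hx')
    have h2 := h' (a⁻ * x) (IsFAlgebra.mul_le_mul_left (negPart_nonneg a) hx)
      (IsFAlgebra.mul_le_mul_left (negPart_nonneg a) hx')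
    change c - d' ≤ f (a * x) ∧ f (a * x) ≤ d - c'
    rw [e]
    constructor <;> linarith [h1.1, h1.2, h2.1, h2.2])

@[simp] theorem dualActElem_apply (f : RieszDual A) (a b : A) :
    dualActElem f a b = f (a * b) := rfl

/-- The map `a ↦ f · a`, linear in `a`. -/
noncomputable def dualActElemLin (f : RieszDual A) : A →ₗ[ℝ] RieszDual A where
  toFun a := dualActElem f a
  map_add' a b := RieszDual.ext_apply fun x => by simp [add_mul]
  map_smul' r a := RieszDual.ext_apply fun x => by simp [smul_mul_assoc]

@[simp] theorem dualActElemLin_apply (f : RieszDual A) (a : A) :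
    dualActElemLin f a = dualActElem f a := rfl

theorem dualActElem_mono {f : RieszDual A} (hf : 0 ≤ f) {a b : A} (h : a ≤ b) :
    dualActElem f a ≤ dualActElem f b := fun x hx => by
  simpa using RieszDual.mono hf (IsFAlgebra.mul_le_mul_right hx h)

/-- For `F ∈ (A~)~_n` and `f ∈ A~`, the functional `F · f ∈ A~` with `(F · f) a = F (f · a)`. -/
noncomputable def bidualAct (F : NormalDual (RieszDual A)) (f : RieszDual A) : RieszDual A :=
  RieszDual.mk (F.toDual.toLin ∘ₗ dualActElemLin f) (by
    intro u v
    obtain ⟨c, d, h⟩ := F.toDual.bounded (dualActElem f⁺ u - dualActElem f⁻ v)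
      (dualActElem f⁺ v - dualActElem f⁻ u)
    refine ⟨c, d, fun x hx hx' => ?_⟩
    have e : dualActElem f x = dualActElem f⁺ x - dualActElem f⁻ x :=
      RieszDual.ext_apply fun y => by
        rw [RieszDual.sub_apply, dualActElem_apply, dualActElem_apply, dualActElem_apply,
          ← RieszDual.sub_apply, posPart_sub_negPart]
    apply h
    · rw [dualActElemLin_apply, e]
      exact sub_le_sub (dualActElem_mono (posPart_nonneg f) hx)
        (dualActElem_mono (negPart_nonneg f) hx')
    · rw [dualActElemLin_apply, e]
      exact sub_le_sub (dualActElem_mono (posPart_nonneg f) hx')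
        (dualActElem_mono (negPart_nonneg f) hx))

@[simp] theorem bidualAct_apply (F : NormalDual (RieszDual A)) (f : RieszDual A) (a : A) :
    bidualAct F f a = F.toDual (dualActElem f a) := rfl

end Action

open Filter Topology

/-! ### Disjointness in lattice-ordered groups. -/

section LatticeGroup

variable {E : Type*} [AddCommGroup E] [Lattice E] [IsOrderedAddMonoid E]

/-! The action is bilinear and positive, so splitting `F` and `f` into positive and negative parts
writes `F · f` as a difference of two sums of positive terms, whose sum is `|F| · |f|`. The modulus
formula holds once these two sums are disjoint. This needs disjointness to be preserved in each
variable separately.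

The algebraic input replaces `y ≤ 1 + y²` when there is no unit: `c * y ≤ c + c * y * y` for `c, y ≥
0`, together with its left-handed twin. Rescaling `y` gives `f (c * y) ≤ t * f c + t⁻¹ * f (c * y *
y)` for every `t > 0`, so smallness of `f` at `c` passes to `c * y`.

In the variable `f` (`bidualAct_inf_eq_zero`): if `f ⊓ g = 0`, each `x ≥ 0` has a decreasing
sequence `c m ≤ x` with `f (c m) → 0` and `g (x - c m)` small. By the estimate `f · c m ↓ 0`, and
order continuity gives `F (f · c m) → 0`; hence `F · f ⊥ g`.

In the variable `F` (`bidualAct_inf_bidualAct_eq_zero_of_inf_eq_zero`): order continuity splits `f`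
as `p + q` with `G p = 0` and `F q = 0`. The left-handed estimate shows that `F q = 0` forces `F · q
= 0` (`bidualAct_eq_zero`), so `F` acts only through `p` and `G` only through `q`, which reduces to
the first case. -/

theorem inf_add_eq_zero_of_inf_eq_zero {a b c : E} (ha : 0 ≤ a) (hb : 0 ≤ b) (hc : 0 ≤ c)
    (hab : a ⊓ b = 0) (hac : a ⊓ c = 0) : a ⊓ (b + c) = 0 := by
  apply le_antisymm _ (le_inf ha (add_nonneg hb hc))
  have h1 : a ⊓ (b + c) - b ≤ a ⊓ c :=
    le_inf (sub_le_iff_le_add.2 (inf_le_left.trans (le_add_of_nonneg_right hb)))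
      (sub_le_iff_le_add'.2 inf_le_right)
  rw [hac, sub_nonpos] at h1
  exact (le_inf inf_le_left h1).trans hab.le

theorem abs_sub_eq_add_of_inf_eq_zero {u v : E} (h : u ⊓ v = 0) : |u - v| = u + v := by
  have h1 := inf_add_sup u v
  have h2 := sup_sub_inf_eq_abs_sub u v
  rw [h, zero_add] at h1
  rw [abs_sub_comm, ← h2, h, h1, sub_zero]

theorem sub_inf_self_inf_sub_inf_self (a b : E) : (a - a ⊓ b) ⊓ (b - a ⊓ b) = 0 := by
  rw [sub_eq_add_neg, sub_eq_add_neg, ← inf_add, add_neg_cancel]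

end LatticeGroup

/-! ### Disjoint functionals -/

namespace RieszDual

variable {E : Type u} [AddCommGroup E] [Lattice E] [IsOrderedAddMonoid E] [Module ℝ E]
  [IsOrderedModule ℝ E]

/-- Riesz–Kantorovich: `(f ⊓ g) x` is the infimum of `f b + g (x - b)` over `0 ≤ b ≤ x`. -/
theorem exists_add_lt_of_inf_eq_zero {f g : RieszDual E} (h : f ⊓ g = 0) {x : E} (hx : 0 ≤ x)
    {ε : ℝ} (hε : 0 < ε) : ∃ b, 0 ≤ b ∧ b ≤ x ∧ f b + g (x - b) < ε := by
  by_contra! hcon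
  have h1 : (f ⊓ g) x = f x - (f - g).posVal x := by
    rw [inf_def, sub_apply, pos_apply _ hx]
  have h2 : (f - g).posVal x ≤ f x - ε := by
    refine posVal_le _ hx fun y hy hyx => ?_
    have := hcon (x - y) (sub_nonneg.2 hyx) (sub_le_self _ hy)
    rw [sub_sub_cancel, map_sub] at this
    rw [sub_apply]
    linarith
  rw [h, zero_apply] at h1
  linarith

theorem inf_eq_zero_of_forall_exists {f g : RieszDual E} (hf : 0 ≤ f) (hg : 0 ≤ g)
    (h : ∀ x, 0 ≤ x → ∀ ε : ℝ, 0 < ε → ∃ b, 0 ≤ b ∧ b ≤ x ∧ f b + g (x - b) ≤ ε) :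
    f ⊓ g = 0 := by
  apply le_antisymm _ (le_inf hf hg)
  intro x hx
  refine le_of_forall_pos_le_add fun ε hε => ?_
  obtain ⟨b, hb, hbx, hε'⟩ := h x hx ε hε
  have h1 : (f ⊓ g) b ≤ f b := inf_le_left (a := f) (b := g) b hb
  have h2 : (f ⊓ g) (x - b) ≤ g (x - b) := inf_le_right (a := f) (b := g) _ (sub_nonneg.2 hbx)
  rw [map_sub] at h2
  rw [zero_apply]
  linarith

/-- If `f ⊓ g = 0`, every `x ≥ 0` dominates a decreasing sequence along which `f` tends to `0`
and on which `g` is almost as large as at `x`. -/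
theorem exists_antitone_of_inf_eq_zero {f g : RieszDual E} (hf : 0 ≤ f) (hg : 0 ≤ g)
    (h : f ⊓ g = 0) {x : E} (hx : 0 ≤ x) {ε : ℝ} (hε : 0 < ε) :
    ∃ c : ℕ → E, Antitone c ∧ (∀ m, 0 ≤ c m) ∧ (∀ m, c m ≤ x) ∧
      Tendsto (fun m => f (c m)) atTop (𝓝 0) ∧ ∀ m, g (x - c m) ≤ ε := by
  -- The sequence is `c m = b 0 ⊓ ⋯ ⊓ b m`. Since `x - c m` is at most the sum of the `x - b k`, the
  -- errors at `g` add up, and these tolerances sum to at most `ε`.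
  have hpos : ∀ k : ℕ, 0 < ε * (1 / 2) ^ (k + 1) := fun k => by positivity
  choose b hb hbx hbε using fun k => exists_add_lt_of_inf_eq_zero h hx (hpos k)
  let c : ℕ → E := fun m => Nat.rec (b 0) (fun k y => y ⊓ b (k + 1)) m
  have hc0 : c 0 = b 0 := rfl
  have hcs : ∀ m, c (m + 1) = c m ⊓ b (m + 1) := fun m => rfl
  have hcn : ∀ m, 0 ≤ c m := fun m => by
    induction m with
    | zero => exact hb 0
    | succ m ih => exact hcs m ▸ le_inf ih (hb _)
  have hcb : ∀ m, c m ≤ b m := fun m => by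
    cases m with
    | zero => exact le_rfl
    | succ m => exact inf_le_right
  have hfb : ∀ m, f (b m) ≤ ε * (1 / 2) ^ (m + 1) := fun m => by
    have := nonneg_apply hg (sub_nonneg.2 (hbx m))
    linarith [hbε m]
  have hgb : ∀ m, g (x - b m) ≤ ε * (1 / 2) ^ (m + 1) := fun m => by
    have := nonneg_apply hf (hb m)
    linarith [hbε m]
  have hgc : ∀ m, g (x - c m) ≤ ε * (1 - (1 / 2) ^ (m + 1)) := fun m => by
    induction m with
    | zero =>
      have := hgb 0
      rw [hc0]
      norm_num at this ⊢
      linarith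
    | succ m ih =>
      have h1 : x - c (m + 1) ≤ (x - c m) + (x - b (m + 1)) := by
        rw [hcs, sub_le_iff_le_add, add_inf]
        refine le_inf ?_ ?_
        · rw [add_right_comm, sub_add_cancel]
          exact le_add_of_nonneg_right (sub_nonneg.2 (hbx _))
        · rw [add_assoc, sub_add_cancel]
          exact le_add_of_nonneg_left (sub_nonneg.2 ((hcb m).trans (hbx m)))
      have h2 := mono hg h1
      rw [map_add] at h2
      have h3 := hgb (m + 1)
      have h4 : (1 / 2 : ℝ) ^ (m + 1) = 2 * (1 / 2) ^ (m + 1 + 1) := by ring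
      rw [h4] at ih
      linarith
  refine ⟨c, antitone_nat_of_succ_le fun m => (hcs m).le.trans inf_le_left, hcn,
    fun m => (hcb m).trans (hbx m), ?_, fun m => (hgc m).trans ?_⟩
  · refine squeeze_zero (fun m => nonneg_apply hf (hcn m))
      (fun m => (mono hf (hcb m)).trans (hfb m)) ?_
    have := (tendsto_pow_atTop_nhds_zero_of_lt_one (r := (1 / 2 : ℝ)) (by norm_num)
      (by norm_num)).comp (tendsto_add_atTop_nat 1)
    simpa using this.const_mul ε
  · have : (0 : ℝ) ≤ (1 / 2) ^ (m + 1) := by positivity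
    nlinarith

/-- A decreasing sequence of positive functionals has an infimum. -/
theorem exists_isGLB_range {c : ℕ → RieszDual E} (hc : Antitone c) (hn : ∀ m, 0 ≤ c m) :
    ∃ l : RieszDual E, 0 ≤ l ∧ IsGLB (Set.range c) l := by
  have hpos : ∀ x : E, 0 ≤ x → ∃ r : ℝ, Tendsto (fun m => c m x) atTop (𝓝 r) := fun x hx =>
    ⟨_, tendsto_atTop_ciInf (fun i j h => hc h x hx)
      ⟨0, by rintro _ ⟨m, rfl⟩; exact nonneg_apply (hn m) hx⟩⟩
  have hlim : ∀ x : E, ∃ r : ℝ, Tendsto (fun m => c m x) atTop (𝓝 r) := fun x => by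
    obtain ⟨r, hr⟩ := hpos x⁺ (posPart_nonneg x)
    obtain ⟨s, hs⟩ := hpos x⁻ (negPart_nonneg x)
    refine ⟨r - s, (hr.sub hs).congr fun m => ?_⟩
    rw [← map_sub, posPart_sub_negPart]
  choose l hl using hlim
  let L : E →ₗ[ℝ] ℝ :=
    { toFun := l
      map_add' := fun x y => tendsto_nhds_unique (hl (x + y))
        (((hl x).add (hl y)).congr fun m => (map_add _ _ _).symm)
      map_smul' := fun r x => tendsto_nhds_unique (hl (r • x))
        (((hl x).const_mul r).congr fun m => (map_smul (c m).toLin r x).symm) }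
  have hLn : ∀ x, 0 ≤ x → 0 ≤ L x := fun x hx =>
    ge_of_tendsto' (hl x) fun m => nonneg_apply (hn m) hx
  refine ⟨mk L (bounded_of_nonneg L hLn), hLn, ?_, ?_⟩
  · rintro _ ⟨m, rfl⟩ x hx
    exact Antitone.le_of_tendsto (f := fun m => c m x) (fun i j h => hc h x hx) (hl x) m
  · intro w hw x hx
    exact ge_of_tendsto' (hl x) fun m => hw ⟨m, rfl⟩ x hx

theorem isGLB_zero_of_tendsto {c : ℕ → RieszDual E} (hn : ∀ m, 0 ≤ c m)
    (h : ∀ x, 0 ≤ x → Tendsto (fun m => c m x) atTop (𝓝 0)) : IsGLB (Set.range c) 0 := by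
  refine ⟨?_, fun w hw x hx => ge_of_tendsto' (h x hx) fun m => hw ⟨m, rfl⟩ x hx⟩
  rintro _ ⟨m, rfl⟩
  exact hn m

end RieszDual

/-! ### Order continuous functionals: sequential continuity and splitting. -/

namespace NormalDual

section

variable {E : Type u} [AddCommGroup E] [Lattice E] [IsOrderedAddMonoid E] [Module ℝ E]
  [IsOrderedModule ℝ E]

theorem tendsto_zero_of_isGLB (F : NormalDual E) {c : ℕ → E} (hc : Antitone c)
    (h : IsGLB (Set.range c) 0) : Tendsto (fun m => F.toDual (c m)) atTop (𝓝 0) := by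
  -- Order continuity is tested on index sets in universe `u`, so the sequence is reindexed by a
  -- lift of `ℕ`.
  have hr : Set.range (fun i : ULift.{u} ℕ => c i.down) = Set.range c :=
    ULift.down_surjective.range_comp c
  have : IsDirected (ULift.{u} ℕ) (· ≤ ·) :=
    ⟨fun i j => ⟨⟨max i.down j.down⟩, le_max_left i.down j.down, le_max_right i.down j.down⟩⟩
  obtain ⟨y, hy, hy0, hxy⟩ := F.isOrderContinuous (ULift.{u} ℕ) (fun i => c i.down)
    ⟨fun i => c i.down, fun i j hij => hc hij, hr ▸ h,
      fun i => (abs_of_nonneg (h.1 ⟨i.down, rfl⟩)).le⟩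
  have hr' : Set.range (fun m : ℕ => y ⟨m⟩) = Set.range y := ULift.up_surjective.range_comp y
  have hlim : Tendsto (fun m : ℕ => y ⟨m⟩) atTop (𝓝 0) :=
    tendsto_atTop_isGLB (fun i j hij => hy hij) (hr' ▸ hy0)
  exact squeeze_zero_norm (fun m => hxy ⟨m⟩) hlim

theorem tendsto_of_isGLB (F : NormalDual E) {c : ℕ → E} (hc : Antitone c) {l : E}
    (h : IsGLB (Set.range c) l) : Tendsto (fun m => F.toDual (c m)) atTop (𝓝 (F.toDual l)) := by
  have h0 : IsGLB (Set.range fun m => c m - l) 0 := by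
    refine ⟨?_, fun w hw => ?_⟩
    · rintro _ ⟨m, rfl⟩
      exact sub_nonneg.2 (h.1 ⟨m, rfl⟩)
    · have : w + l ≤ l := h.2 (by
        rintro _ ⟨m, rfl⟩
        exact le_sub_iff_add_le.1 (hw ⟨m, rfl⟩))
      simpa using this
  have h1 := (F.tendsto_zero_of_isGLB (fun i j hij => sub_le_sub_right (hc hij) l) h0).add_const
    (F.toDual l)
  simpa using h1

end

variable {E : Type u} [AddCommGroup E] [Lattice E] [IsOrderedAddMonoid E] [Module ℝ E]
  [IsOrderedModule ℝ E] {F G : NormalDual (RieszDual E)}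

/-- Take the infimum of a decreasing sequence along which `G` tends to `0`: order continuity makes
`G` vanish there exactly and keeps the bound on `F`. -/
theorem exists_apply_eq_zero_apply_sub_le (hF : 0 ≤ F) (hG : 0 ≤ G) (h : F ⊓ G = 0)
    {f : RieszDual E} (hf : 0 ≤ f) {ε : ℝ} (hε : 0 < ε) :
    ∃ c, 0 ≤ c ∧ c ≤ f ∧ G.toDual c = 0 ∧ F.toDual (f - c) ≤ ε := by
  have h' : G.toDual ⊓ F.toDual = 0 := by
    rw [inf_comm]
    exact congrArg toDual h
  obtain ⟨c, hc, hc0, hcf, hGc, hFc⟩ :=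
    RieszDual.exists_antitone_of_inf_eq_zero (toDual_le.2 hG) (toDual_le.2 hF) h' hf hε
  obtain ⟨l, hl0, hl⟩ := RieszDual.exists_isGLB_range hc hc0
  refine ⟨l, hl0, (hl.1 ⟨0, rfl⟩).trans (hcf 0),
    tendsto_nhds_unique (G.tendsto_of_isGLB hc hl) hGc, ?_⟩
  have h1 := (F.tendsto_of_isGLB hc hl).const_sub (F.toDual f)
  rw [map_sub]
  refine le_of_tendsto' h1 fun m => ?_
  rw [← map_sub]
  exact hFc m

/-- Disjoint order continuous functionals live on complementary parts of each `f ≥ 0`. -/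
theorem exists_apply_eq_zero_apply_sub_eq_zero (hF : 0 ≤ F) (hG : 0 ≤ G) (h : F ⊓ G = 0)
    {f : RieszDual E} (hf : 0 ≤ f) :
    ∃ p, 0 ≤ p ∧ p ≤ f ∧ G.toDual p = 0 ∧ F.toDual (f - p) = 0 := by
  have hF' : 0 ≤ F.toDual := toDual_le.2 hF
  have hG' : 0 ≤ G.toDual := toDual_le.2 hG
  choose c hc0 hcf hGc hFc using fun n : ℕ =>
    exists_apply_eq_zero_apply_sub_le hF hG h hf (Nat.one_div_pos_of_nat (α := ℝ) (n := n))
  -- `s m = c 0 ⊔ ⋯ ⊔ c m` is still killed by `G`. Its supremum is the required `p`, obtained as `f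
  -- - q` with `q` the infimum of the `f - s m`.
  let s : ℕ → RieszDual E := fun m => Nat.rec (c 0) (fun k y => y ⊔ c (k + 1)) m
  have hss : ∀ m, s (m + 1) = s m ⊔ c (m + 1) := fun m => rfl
  have hcs : ∀ m, c m ≤ s m := fun m => by
    cases m with
    | zero => exact le_rfl
    | succ m => exact hss m ▸ le_sup_right
  have hs0 : ∀ m, 0 ≤ s m := fun m => (hc0 m).trans (hcs m)
  have hsf : ∀ m, s m ≤ f := fun m => by
    induction m with
    | zero => exact hcf 0
    | succ m ih => exact hss m ▸ sup_le ih (hcf _)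
  have hGs : ∀ m, G.toDual (s m) = 0 := fun m => by
    induction m with
    | zero => exact hGc 0
    | succ m ih =>
      refine le_antisymm ?_ (RieszDual.nonneg_apply hG' (hs0 (m + 1)))
      have h1 : s (m + 1) ≤ s m + c (m + 1) := hss m ▸
        sup_le (le_add_of_nonneg_right (hc0 _)) (le_add_of_nonneg_left (hs0 m))
      have h2 := RieszDual.mono hG' h1
      rwa [map_add, ih, hGc, add_zero] at h2
  have hanti : Antitone fun m => f - s m :=
    antitone_nat_of_succ_le fun m => sub_le_sub_left (hss m ▸ le_sup_left) f
  obtain ⟨q, hq0, hq⟩ := RieszDual.exists_isGLB_range hanti fun m => sub_nonneg.2 (hsf m)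
  refine ⟨f - q, sub_nonneg.2 ((hq.1 ⟨0, rfl⟩).trans (sub_le_self f (hs0 0))),
    sub_le_self f hq0, ?_, ?_⟩
  · have h1 := G.tendsto_of_isGLB hanti hq
    simp only [map_sub, hGs, sub_zero] at h1
    rw [map_sub, tendsto_nhds_unique h1 tendsto_const_nhds, sub_self]
  · rw [sub_sub_cancel]
    refine le_antisymm (ge_of_tendsto' (tendsto_one_div_add_atTop_nhds_zero_nat (𝕜 := ℝ))
      fun n => ?_) (RieszDual.nonneg_apply hF' hq0)
    exact (RieszDual.mono hF' ((hq.1 ⟨n, rfl⟩).trans (sub_le_sub_left (hcs n) f))).trans (hFc n)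

end NormalDual

/-! ### The actions of an `f`-algebra -/

section Action

variable {A : Type u} [NonUnitalRing A] [Lattice A] [IsOrderedAddMonoid A] [Module ℝ A]
  [IsOrderedModule ℝ A] [IsScalarTower ℝ A A] [SMulCommClass ℝ A A] [IsFAlgebra A]

/-! ### The quadratic estimate and its consequences for functionals. -/

namespace IsFAlgebra

/-- With `v = c * y - c`, the difference of the two sides is `v * y + c`, so it suffices that `v⁻ *
y ≤ c`. Since `v⁻ ≤ c`, the element `v⁻ * y - c` lies below both `v⁻ * y` and `v⁺`, and these are
disjoint by the `f`-algebra axiom. -/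
theorem mul_le_add_mul_mul_right {c y : A} (hc : 0 ≤ c) (hy : 0 ≤ y) :
    c * y ≤ c + c * y * y := by
  set v := c * y - c with hv
  have hvc : v⁻ ≤ c := by
    rw [negPart_def, hv, neg_sub]
    exact sup_le (sub_le_self c (mul_nonneg _ _ hc hy)) hc
  have h1 : v⁻ * y - c ≤ v⁻ * y ⊓ v⁺ :=
    le_inf (sub_le_self _ hc)
      ((sub_le_sub_right (mul_le_mul_right hy hvc) c).trans (le_posPart v))
  rw [mul_right_inf _ _ y ((inf_comm _ _).trans (posPart_inf_negPart_eq_zero v)) hy,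
    sub_nonpos] at h1
  have h2 : c * y * y - c * y = v⁺ * y - v⁻ * y := by
    rw [← sub_mul, ← sub_mul, posPart_sub_negPart]
  have h3 : 0 ≤ v⁺ * y := mul_nonneg _ _ (posPart_nonneg v) hy
  rw [← sub_nonneg, show c + c * y * y - c * y = v⁺ * y + (c - v⁻ * y) by
    rw [add_sub_assoc, h2]; abel]
  exact add_nonneg h3 (sub_nonneg.2 h1)

theorem mul_le_add_mul_mul_left {c y : A} (hc : 0 ≤ c) (hy : 0 ≤ y) :
    y * c ≤ c + y * (y * c) := by
  set v := y * c - c with hv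
  have hvc : v⁻ ≤ c := by
    rw [negPart_def, hv, neg_sub]
    exact sup_le (sub_le_self c (mul_nonneg _ _ hy hc)) hc
  have h1 : y * v⁻ - c ≤ y * v⁻ ⊓ v⁺ :=
    le_inf (sub_le_self _ hc)
      ((sub_le_sub_right (mul_le_mul_left hy hvc) c).trans (le_posPart v))
  rw [mul_left_inf _ _ y ((inf_comm _ _).trans (posPart_inf_negPart_eq_zero v)) hy,
    sub_nonpos] at h1
  have h2 : y * (y * c) - y * c = y * v⁺ - y * v⁻ := by
    rw [← mul_sub, ← mul_sub, posPart_sub_negPart]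
  have h3 : 0 ≤ y * v⁺ := mul_nonneg _ _ hy (posPart_nonneg v)
  rw [← sub_nonneg, show c + y * (y * c) - y * c = y * v⁺ + (c - y * v⁻) by
    rw [add_sub_assoc, h2]; abel]
  exact add_nonneg h3 (sub_nonneg.2 h1)

end IsFAlgebra

namespace RieszDual

theorem apply_mul_right_le {f : RieszDual A} (hf : 0 ≤ f) {c y : A} (hc : 0 ≤ c) (hy : 0 ≤ y)
    {t : ℝ} (ht : 0 < t) : f (c * y) ≤ t * f c + t⁻¹ * f (c * y * y) := by
  have h := mono hf (IsFAlgebra.mul_le_add_mul_mul_right hc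
    (smul_nonneg (inv_nonneg.2 ht.le) hy))
  simp only [mul_smul_comm, smul_mul_assoc, map_add, map_smul, smul_eq_mul] at h
  have h' := mul_le_mul_of_nonneg_left h ht.le
  rwa [mul_inv_cancel_left₀ ht.ne', mul_add, mul_inv_cancel_left₀ ht.ne'] at h'

theorem apply_mul_left_le {f : RieszDual A} (hf : 0 ≤ f) {c y : A} (hc : 0 ≤ c) (hy : 0 ≤ y)
    {t : ℝ} (ht : 0 < t) : f (y * c) ≤ t * f c + t⁻¹ * f (y * (y * c)) := by
  have h := mono hf (IsFAlgebra.mul_le_add_mul_mul_left hc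
    (smul_nonneg (inv_nonneg.2 ht.le) hy))
  simp only [mul_smul_comm, smul_mul_assoc, map_add, map_smul, smul_eq_mul] at h
  have h' := mul_le_mul_of_nonneg_left h ht.le
  rwa [mul_inv_cancel_left₀ ht.ne', mul_add, mul_inv_cancel_left₀ ht.ne'] at h'

theorem tendsto_apply_mul_right {f : RieszDual A} (hf : 0 ≤ f) {c : ℕ → A} {x y : A}
    (hc : ∀ m, 0 ≤ c m) (hcx : ∀ m, c m ≤ x) (hy : 0 ≤ y)
    (h : Tendsto (fun m => f (c m)) atTop (𝓝 0)) :
    Tendsto (fun m => f (c m * y)) atTop (𝓝 0) := by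
  set K := f (x * y * y) with hK
  have hK0 : 0 ≤ K := nonneg_apply hf (IsFAlgebra.mul_nonneg _ _
    (IsFAlgebra.mul_nonneg _ _ ((hc 0).trans (hcx 0)) hy) hy)
  have hn : ∀ m, 0 ≤ f (c m * y) := fun m =>
    nonneg_apply hf (IsFAlgebra.mul_nonneg _ _ (hc m) hy)
  rw [Metric.tendsto_atTop] at h ⊢
  intro ε hε
  -- Chosen so that `t⁻¹ * K ≤ ε / 2`; the `+ 1` keeps `t` positive when `K = 0`.
  set t := 2 * (K + 1) / ε with ht
  have ht0 : 0 < t := by positivity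
  obtain ⟨N, hN⟩ := h (ε / (2 * t)) (by positivity)
  refine ⟨N, fun m hm => ?_⟩
  have h1 := hN m hm
  rw [Real.dist_0_eq_abs, abs_of_nonneg (nonneg_apply hf (hc m))] at h1
  rw [Real.dist_0_eq_abs, abs_of_nonneg (hn m)]
  have h2 := apply_mul_right_le hf (hc m) hy ht0
  have h3 : f (c m * y * y) ≤ K := mono hf
    (IsFAlgebra.mul_le_mul_right hy (IsFAlgebra.mul_le_mul_right hy (hcx m)))
  have h4 : t * f (c m) < ε / 2 := by
    rw [lt_div_iff₀ (by positivity)] at h1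
    linarith
  have h5 : t⁻¹ * f (c m * y * y) ≤ t⁻¹ * K :=
    mul_le_mul_of_nonneg_left h3 (inv_nonneg.2 ht0.le)
  have h6 : t⁻¹ * K ≤ ε / 2 := by
    rw [ht, inv_div, div_mul_eq_mul_div, div_le_div_iff₀ (by positivity) (by norm_num)]
    nlinarith
  linarith

end RieszDual

/-! ### Positivity, bilinearity and preservation of disjointness. -/

theorem dualActElem_nonneg {f : RieszDual A} (hf : 0 ≤ f) {a : A} (ha : 0 ≤ a) :
    0 ≤ dualActElem f a := fun x hx => by
  simpa using RieszDual.nonneg_apply hf (IsFAlgebra.mul_nonneg _ _ ha hx)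

theorem bidualAct_nonneg {F : NormalDual (RieszDual A)} (hF : 0 ≤ F) {f : RieszDual A}
    (hf : 0 ≤ f) : 0 ≤ bidualAct F f := fun _ hx =>
  RieszDual.nonneg_apply (NormalDual.toDual_le.2 hF) (dualActElem_nonneg hf hx)

theorem bidualAct_add (F : NormalDual (RieszDual A)) (f g : RieszDual A) :
    bidualAct F (f + g) = bidualAct F f + bidualAct F g := RieszDual.ext_apply fun a => by
  have : dualActElem (f + g) a = dualActElem f a + dualActElem g a :=
    RieszDual.ext_apply fun x => rfl
  simp [this]

theorem add_bidualAct (F G : NormalDual (RieszDual A)) (f : RieszDual A) :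
    bidualAct (F + G) f = bidualAct F f + bidualAct G f := RieszDual.ext_apply fun a => by
  simp

theorem bidualAct_sub (F : NormalDual (RieszDual A)) (f g : RieszDual A) :
    bidualAct F (f - g) = bidualAct F f - bidualAct F g := by
  rw [eq_sub_iff_add_eq, ← bidualAct_add, sub_add_cancel]

theorem sub_bidualAct (F G : NormalDual (RieszDual A)) (f : RieszDual A) :
    bidualAct (F - G) f = bidualAct F f - bidualAct G f := by
  rw [eq_sub_iff_add_eq, ← add_bidualAct, sub_add_cancel]

/-- `f ↦ F · f` preserves disjointness from a fixed functional. -/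
theorem bidualAct_inf_eq_zero {F : NormalDual (RieszDual A)} (hF : 0 ≤ F) {f g : RieszDual A}
    (hf : 0 ≤ f) (hg : 0 ≤ g) (h : f ⊓ g = 0) : bidualAct F f ⊓ g = 0 := by
  refine RieszDual.inf_eq_zero_of_forall_exists (bidualAct_nonneg hF hf) hg fun x hx ε hε => ?_
  obtain ⟨c, hc, hc0, hcx, hfc, hgc⟩ :=
    RieszDual.exists_antitone_of_inf_eq_zero hf hg h hx (half_pos hε)
  have h1 : IsGLB (Set.range fun m => dualActElem f (c m)) 0 :=
    RieszDual.isGLB_zero_of_tendsto (fun m => dualActElem_nonneg hf (hc0 m))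
      fun y hy => RieszDual.tendsto_apply_mul_right hf hc0 hcx hy hfc
  have h2 := F.tendsto_zero_of_isGLB (fun i j hij => dualActElem_mono hf (hc hij)) h1
  obtain ⟨m, hm⟩ := (h2.eventually_lt_const (half_pos hε)).exists
  refine ⟨c m, hc0 m, hcx m, ?_⟩
  rw [bidualAct_apply]
  linarith [hgc m]

theorem bidualAct_inf_bidualAct_eq_zero {F G : NormalDual (RieszDual A)} (hF : 0 ≤ F)
    (hG : 0 ≤ G) {f g : RieszDual A} (hf : 0 ≤ f) (hg : 0 ≤ g) (h : f ⊓ g = 0) :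
    bidualAct F f ⊓ bidualAct G g = 0 := by
  -- Apply the one-sided result twice, first replacing `f` by `F · f`, then `g` by `G · g`.
  rw [inf_comm]
  refine bidualAct_inf_eq_zero hG hg (bidualAct_nonneg hF hf) ?_
  rw [inf_comm]
  exact bidualAct_inf_eq_zero hF hf hg h

/-- The left-handed estimate with `t = n + 1` bounds `f · x` by `t • f + t⁻¹ • (f · (x * x))`.
Applying `F` kills the first term, and the second vanishes as `n → ∞`. -/
theorem bidualAct_eq_zero {F : NormalDual (RieszDual A)} (hF : 0 ≤ F) {f : RieszDual A}
    (hf : 0 ≤ f) (h : F.toDual f = 0) : bidualAct F f = 0 := by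
  have hF' : 0 ≤ F.toDual := NormalDual.toDual_le.2 hF
  refine RieszDual.ext_nonneg fun x hx =>
    le_antisymm ?_ (RieszDual.nonneg_apply (bidualAct_nonneg hF hf) hx)
  rw [RieszDual.zero_apply, bidualAct_apply]
  have hlim : Tendsto (fun n : ℕ => 1 / ((n : ℝ) + 1) * F.toDual (dualActElem f (x * x))) atTop
      (𝓝 0) := by
    simpa using (tendsto_one_div_add_atTop_nhds_zero_nat (𝕜 := ℝ)).mul_const
      (F.toDual (dualActElem f (x * x)))
  refine ge_of_tendsto' hlim fun n => ?_
  have h1 : dualActElem f x ≤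
      ((n : ℝ) + 1) • f + (1 / ((n : ℝ) + 1)) • dualActElem f (x * x) := fun y hy => by
    simpa [mul_assoc] using
      RieszDual.apply_mul_left_le hf hy hx (t := (n : ℝ) + 1) (by positivity)
  have h2 := RieszDual.mono hF' h1
  rwa [map_add, map_smul, map_smul, h, smul_zero, zero_add, smul_eq_mul] at h2

/-- `F ↦ F · f` preserves disjointness for `f ≥ 0`. -/
theorem bidualAct_inf_bidualAct_eq_zero_of_inf_eq_zero {F G : NormalDual (RieszDual A)}
    (hF : 0 ≤ F) (hG : 0 ≤ G) (h : F ⊓ G = 0) {f : RieszDual A} (hf : 0 ≤ f) :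
    bidualAct F f ⊓ bidualAct G f = 0 := by
  obtain ⟨p, hp, hpf, hGp, hFq⟩ :=
    NormalDual.exists_apply_eq_zero_apply_sub_eq_zero hF hG h hf
  set q := f - p with hq
  have hq0 : 0 ≤ q := sub_nonneg.2 hpf
  -- `p` and `q` may overlap, but both `F` and `G` vanish on `p ⊓ q`; subtracting it leaves disjoint
  -- functionals and changes neither action.
  have hr : 0 ≤ p ⊓ q := le_inf hp hq0
  have hfpq : f = p + q := by rw [hq, add_sub_cancel]
  have hFr : F.toDual (p ⊓ q) = 0 := le_antisymm
    ((RieszDual.mono (NormalDual.toDual_le.2 hF) inf_le_right).trans hFq.le)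
    (RieszDual.nonneg_apply (NormalDual.toDual_le.2 hF) hr)
  have hGr : G.toDual (p ⊓ q) = 0 := le_antisymm
    ((RieszDual.mono (NormalDual.toDual_le.2 hG) inf_le_left).trans hGp.le)
    (RieszDual.nonneg_apply (NormalDual.toDual_le.2 hG) hr)
  have hFf : bidualAct F f = bidualAct F (p - p ⊓ q) := by
    rw [bidualAct_sub, bidualAct_eq_zero hF hr hFr, sub_zero, hfpq, bidualAct_add,
      bidualAct_eq_zero hF hq0 hFq, add_zero]
  have hGf : bidualAct G f = bidualAct G (q - p ⊓ q) := by
    rw [bidualAct_sub, bidualAct_eq_zero hG hr hGr, sub_zero, hfpq, bidualAct_add,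
      bidualAct_eq_zero hG hp hGp, zero_add]
  rw [hFf, hGf]
  exact bidualAct_inf_bidualAct_eq_zero hF hG (sub_nonneg.2 inf_le_left)
    (sub_nonneg.2 inf_le_right) (sub_inf_self_inf_sub_inf_self p q)

theorem abs_bidualAct (F : NormalDual (RieszDual A)) (f : RieszDual A) :
    |bidualAct F f| = bidualAct |F| |f| := by
  have hF := posPart_nonneg F
  have hF' := negPart_nonneg F
  have hf := posPart_nonneg f
  have hf' := negPart_nonneg f
  have hFF : F⁺ ⊓ F⁻ = 0 := posPart_inf_negPart_eq_zero F
  have hff : f⁺ ⊓ f⁻ = 0 := posPart_inf_negPart_eq_zero f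
  have hFF' : F⁻ ⊓ F⁺ = 0 := (inf_comm _ _).trans hFF
  have hff' : f⁻ ⊓ f⁺ = 0 := (inf_comm _ _).trans hff
  have npp := bidualAct_nonneg hF hf
  have npm := bidualAct_nonneg hF hf'
  have nmp := bidualAct_nonneg hF' hf
  have nmm := bidualAct_nonneg hF' hf'
  have h1 : bidualAct F⁺ f⁺ ⊓ (bidualAct F⁺ f⁻ + bidualAct F⁻ f⁺) = 0 :=
    inf_add_eq_zero_of_inf_eq_zero npp npm nmp
      (bidualAct_inf_bidualAct_eq_zero hF hF hf hf' hff)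
      (bidualAct_inf_bidualAct_eq_zero_of_inf_eq_zero hF hF' hFF hf)
  have h2 : bidualAct F⁻ f⁻ ⊓ (bidualAct F⁺ f⁻ + bidualAct F⁻ f⁺) = 0 :=
    inf_add_eq_zero_of_inf_eq_zero nmm npm nmp
      (bidualAct_inf_bidualAct_eq_zero_of_inf_eq_zero hF' hF hFF' hf')
      (bidualAct_inf_bidualAct_eq_zero hF' hF' hf' hf hff')
  -- Each term on the left differs from each on the right in exactly one sign, so only disjointness
  -- in one variable at a time was needed.
  have h3 : (bidualAct F⁺ f⁺ + bidualAct F⁻ f⁻) ⊓ (bidualAct F⁺ f⁻ + bidualAct F⁻ f⁺) = 0 := by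
    rw [inf_comm] at h1 h2 ⊢
    exact inf_add_eq_zero_of_inf_eq_zero (add_nonneg npm nmp) npp nmm h1 h2
  have e1 : bidualAct F f = bidualAct F⁺ f⁺ + bidualAct F⁻ f⁻ -
      (bidualAct F⁺ f⁻ + bidualAct F⁻ f⁺) := by
    conv_lhs => rw [← posPart_sub_negPart F, ← posPart_sub_negPart f]
    rw [sub_bidualAct, bidualAct_sub, bidualAct_sub]
    abel
  have e2 : bidualAct |F| |f| = bidualAct F⁺ f⁺ + bidualAct F⁻ f⁻ +
      (bidualAct F⁺ f⁻ + bidualAct F⁻ f⁺) := by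
    rw [← posPart_add_negPart F, ← posPart_add_negPart f, add_bidualAct, bidualAct_add,
      bidualAct_add]
    abel
  rw [e1, e2, abs_sub_eq_add_of_inf_eq_zero h3]

end Action

theorem corollary2p2 {A : Type u} [NonUnitalRing A] [Lattice A] [IsOrderedAddMonoid A]
    [Module ℝ A] [IsOrderedModule ℝ A] [IsScalarTower ℝ A A] [SMulCommClass ℝ A A] [IsFAlgebra A]
    (hsep : ∀ a : A, (∀ f : RieszDual A, f a = 0) → a = 0) :
    (∀ (F : NormalDual (RieszDual A)) (f : RieszDual A),
      |bidualAct F f| = bidualAct |F| |f|) ∧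
    (∀ f g : RieszDual A, RieszDisjoint f g →
      ∀ F G : NormalDual (RieszDual A), RieszDisjoint (bidualAct F f) (bidualAct G g)) := by
  refine ⟨abs_bidualAct, fun f g hfg F G => ?_⟩
  rw [RieszDisjoint, abs_bidualAct, abs_bidualAct]
  exact bidualAct_inf_bidualAct_eq_zero (abs_nonneg F) (abs_nonneg G) (abs_nonneg f)
    (abs_nonneg g) hfg
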